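/- All rings are commutative with identity $1$. For a ring $R$ and a free $R$-module $F$ of finite rank (such as $R^2$, $R^3$, or the module $\mathbb M_2(R)$ of $2\times 2$ matrices), let $Um(F)$ be the set of unimodular elements of $F$, i.e. of those elements whose coordinates generate the unit ideal of $R$. The ring $R$ is called a Hermite ring if $R^2=R\,Um(R^2)$, i.e. if every pair in $R^2$ is of the form $(da',db')$ with $d\in R$ and $(a',b')\in Um(R^2)$. It is called an $(SU)_2$ ring if it is a Hermite ring and for each $A\in Um(\mathbb M_2(R))$ there exists $N\in GL_2(R)$ such that $AN$ is symmetric. It is called an elementary divisor ring (EDR) if for all positive integers $m,n$ and each $m\times n$ matrix $A$ with entries in $R$ there exist $P\in GL_m(R)$ and $Q\in GL_n(R)$ such that all off-diagonal entries of $PAQ$ are $0$ and each diagonal entry of $PAQ$ divides the next one. Let $R$ be an $(SU)_2$ ring. Then $R$ is an EDR if for all triples $(a,b,c)\in Um(R^3)$ there exists $(e,f)\in R^2$ such that $(ae^2-cf^2,\,ac-b^2)\in Um(R^2)$. The converse holds if $R$ has characteristic $2$: if moreover $R$ is an EDR of characteristic $2$, then for all $(a,b,c)\in Um(R^3)$ there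 exists $(e,f)\in R^2$ such that $(ae^2-cf^2,\,ac-b^2)\in Um(R^2)$. -/

import Mathlib

namespace UnimodularRings

/-- An element `v` of a (free) `R`-module is unimodular if some linear form takes the value `1`
at `v`. For a tuple or a matrix this says that the entries generate the unit ideal, see the
lemmas below. -/
def IsUnimodular (R : Type*) [CommRing R] {M : Type*} [AddCommGroup M] [Module R M] (v : M) :
    Prop :=
  ∃ φ : M →ₗ[R] R, φ v = 1

theorem isUnimodular_pair_iff {R : Type*} [CommRing R] (a b : R) :
    IsUnimodular R (a, b) ↔ ∃ x y : R, x * a + y * b = 1 := by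
  constructor
  · rintro ⟨φ, h⟩
    refine ⟨φ (1, 0), φ (0, 1), ?_⟩
    refine Eq.trans ?_ h
    rw [mul_comm, mul_comm (φ (0, 1)), ← smul_eq_mul, ← smul_eq_mul, ← map_smul, ← map_smul,
      ← map_add]
    simp
  · rintro ⟨x, y, h⟩
    refine ⟨x • LinearMap.fst R R R + y • LinearMap.snd R R R, ?_⟩
    simpa using h

theorem isUnimodular_triple_iff {R : Type*} [CommRing R] (a b c : R) :
    IsUnimodular R (a, b, c) ↔ ∃ x y z : R, x * a + y * b + z * c = 1 := by
  constructor
  · rintro ⟨φ, h⟩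
    refine ⟨φ (1, 0, 0), φ (0, 1, 0), φ (0, 0, 1), ?_⟩
    refine Eq.trans ?_ h
    rw [mul_comm, mul_comm (φ (0, 1, 0)), mul_comm (φ (0, 0, 1)), ← smul_eq_mul,
      ← smul_eq_mul, ← smul_eq_mul, ← map_smul, ← map_smul, ← map_smul, ← map_add, ← map_add]
    simp
  · rintro ⟨x, y, z, h⟩
    refine ⟨x • LinearMap.fst R R (R × R) +
      y • (LinearMap.fst R R R ∘ₗ LinearMap.snd R R (R × R)) +
      z • (LinearMap.snd R R R ∘ₗ LinearMap.snd R R (R × R)), ?_⟩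
    simpa using h

theorem isUnimodular_matrix_iff {R : Type*} [CommRing R] {n : ℕ}
    (A : Matrix (Fin n) (Fin n) R) :
    IsUnimodular R A ↔ ∃ X : Matrix (Fin n) (Fin n) R, ∑ i, ∑ j, X i j * A i j = 1 := by
  constructor
  · rintro ⟨φ, h⟩
    refine ⟨fun i j => φ (Matrix.single i j 1), ?_⟩
    refine Eq.trans ?_ h
    conv_rhs => rw [Matrix.matrix_eq_sum_single A]
    simp only [map_sum]
    refine Finset.sum_congr rfl fun i _ => Finset.sum_congr rfl fun j _ => ?_
    rw [mul_comm, ← smul_eq_mul, ← map_smul, Matrix.smul_single, smul_eq_mul, mul_one]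
  · rintro ⟨X, h⟩
    refine ⟨∑ i, ∑ j, X i j • Matrix.entryLinearMap R R i j, ?_⟩
    simpa using h

/-- Hermite rings in the sense of Kaplansky: `R² = R · Um(R²)`. -/
def IsHermite (R : Type*) [CommRing R] : Prop :=
  ∀ v : R × R, ∃ (d : R) (u : R × R), IsUnimodular R u ∧ v = d • u

/-- `(WSU)ₙ` rings: each unimodular `n × n` matrix becomes symmetric after right multiplication by
some invertible matrix. -/
def IsWSU (n : ℕ) (R : Type*) [CommRing R] : Prop :=
  ∀ A : Matrix (Fin n) (Fin n) R, IsUnimodular R A →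
    ∃ N : Matrix.GeneralLinearGroup (Fin n) R,
      (A * (N : Matrix (Fin n) (Fin n) R)).IsSymm

/-- `(SU)ₙ` rings: Hermite rings that are `(WSU)ₙ` rings. -/
def IsSU (n : ℕ) (R : Type*) [CommRing R] : Prop :=
  IsHermite R ∧ IsWSU n R

/-- A rectangular matrix is in reduced diagonal form if its off-diagonal entries are `0` and each
diagonal entry divides the next one. -/
def IsDiagonalReduced {R : Type*} [CommRing R] {m n : ℕ} (D : Matrix (Fin m) (Fin n) R) : Prop :=
  (∀ (i : Fin m) (j : Fin n), (i : ℕ) ≠ (j : ℕ) → D i j = 0) ∧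
  ∀ (k : ℕ) (hm : k + 1 < m) (hn : k + 1 < n),
    D ⟨k, Nat.lt_of_succ_lt hm⟩ ⟨k, Nat.lt_of_succ_lt hn⟩ ∣ D ⟨k + 1, hm⟩ ⟨k + 1, hn⟩

/-- A matrix admits diagonal reduction if it is equivalent to one in reduced diagonal form. -/
def AdmitsDiagonalReduction {R : Type*} [CommRing R] {m n : ℕ}
    (A : Matrix (Fin m) (Fin n) R) : Prop :=
  ∃ (P : Matrix.GeneralLinearGroup (Fin m) R) (Q : Matrix.GeneralLinearGroup (Fin n) R),
    IsDiagonalReduced ((P : Matrix (Fin m) (Fin m) R) * A * (Q : Matrix (Fin n) (Fin n) R))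

/-- Elementary divisor rings: all matrices, of all sizes, admit diagonal reduction. -/
def IsEDR (R : Type*) [CommRing R] : Prop :=
  ∀ (m n : ℕ) (A : Matrix (Fin m) (Fin n) R), AdmitsDiagonalReduction A

end UnimodularRings

namespace UnimodularRings

open Matrix

variable {R : Type*} [CommRing R]

/-! Everything passes through `RepresentsOne R 2 2`: each unimodular 2 × 2 matrix A satisfies uᵀAv =
1 for some u, v. Over a Hermite ring this makes R an EDR (`IsHermite.isEDR`): the property spreads
to all positive sizes, and dividing a matrix by its content and completing u, v to invertible
matrices splits off a corner 1. Conversely every EDR has the property (`IsEDR.representsOne`).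

The (SU)₂ condition reduces A to a symmetric S with entries a, b, c. Modulo the entries of (e, f)S,
the element ae² - cf² = e(ea + fb) - f(eb + fc) vanishes and det S kills e and f. So if (e, f) is
unimodular, unimodularity of (ae² - cf², det S) forces that of (e, f)S. In the other direction,
(uᵀSu)(vᵀSv) - (uᵀSv)² = det S · (u₀v₁ - u₁v₀)², and in characteristic 2 the value uᵀSu is ae² - cf²
with (e, f) = u. -/

/-- The block diagonal matrix with blocks `d` and `B`, indexed by `Fin`. -/
def bordered {m n : ℕ} (d : R) (B : Matrix (Fin m) (Fin n) R) :
    Matrix (Fin (m + 1)) (Fin (n + 1)) R :=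
  Matrix.of (Fin.cons (Fin.cons d 0) fun i => Fin.cons 0 (B i))

theorem bordered_mul {l m n : ℕ} (d e : R) (B : Matrix (Fin l) (Fin m) R)
    (C : Matrix (Fin m) (Fin n) R) :
    bordered d B * bordered e C = bordered (d * e) (B * C) := by
  ext i j
  refine Fin.cases ?_ (fun i => ?_) i <;> refine Fin.cases ?_ (fun j => ?_) j <;>
    simp [bordered, Matrix.mul_apply, Fin.sum_univ_succ]

theorem bordered_one (n : ℕ) : bordered (1 : R) (1 : Matrix (Fin n) (Fin n) R) = 1 := by
  ext i j
  refine Fin.cases ?_ (fun i => ?_) i <;> refine Fin.cases ?_ (fun j => ?_) j <;>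
    simp [bordered, Matrix.one_apply, (Fin.succ_ne_zero _).symm]

theorem isUnit_bordered {n : ℕ} {B : Matrix (Fin n) (Fin n) R} (hB : IsUnit B) :
    IsUnit (bordered 1 B) := by
  obtain ⟨u, rfl⟩ := hB
  refine IsUnit.of_mul_eq_one (bordered 1 (u⁻¹ : (Matrix (Fin n) (Fin n) R)ˣ).val) ?_
  rw [bordered_mul, Units.mul_inv, one_mul, bordered_one]

/-- The `2 × 2` matrix with entries `a, b, c, d`, extended by an identity block. -/
def cornerBlock (n : ℕ) (a b c d : R) : Matrix (Fin (n + 2)) (Fin (n + 2)) R :=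
  Matrix.of (Fin.cons (Fin.cons a (Fin.cons b 0)) (Fin.cons (Fin.cons c (Fin.cons d 0))
    fun i => Fin.cons 0 (Fin.cons 0 ((1 : Matrix (Fin n) (Fin n) R) i))))

theorem isUnit_cornerBlock (n : ℕ) {a b c d : R} (h : a * d - b * c = 1) :
    IsUnit (cornerBlock n a b c d) := by
  refine IsUnit.of_mul_eq_one (cornerBlock n d (-b) (-c) a) ?_
  have h1 : ∀ j : Fin n, (1 : Fin (n + 2)) ≠ j.succ.succ := fun j => by simp [Fin.ext_iff]
  ext i j
  refine Fin.cases ?_ (fun i => Fin.cases ?_ (fun i => ?_) i) i <;>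
    refine Fin.cases ?_ (fun j => Fin.cases ?_ (fun j => ?_) j) j <;>
    simp [cornerBlock, Matrix.mul_apply, Fin.sum_univ_succ, Matrix.one_apply,
      (Fin.succ_ne_zero _).symm, h1, (h1 _).symm] <;>
    first | linear_combination h | ring

/-! ### Contents and completion of unimodular rows over Hermite rings -/

/-- Over a Hermite ring each vector is a multiple of the first row of an invertible matrix. -/
theorem IsHermite.exists_eq_smul_row (hR : IsHermite R) {n : ℕ} (v : Fin (n + 1) → R) :
    ∃ (g : R) (Q : Matrix (Fin (n + 1)) (Fin (n + 1)) R), IsUnit Q ∧ v = g • Q 0 := by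
  induction n with
  | zero =>
    refine ⟨v 0, 1, isUnit_one, ?_⟩
    ext i
    fin_cases i
    simp
  | succ n ih =>
    obtain ⟨g, Q, hQ, hg⟩ := ih (Fin.tail v)
    obtain ⟨d, ⟨a, b⟩, hu, hd⟩ := hR (v 0, g)
    obtain ⟨x, y, hxy⟩ := (isUnimodular_pair_iff a b).1 hu
    simp only [Prod.smul_mk, smul_eq_mul, Prod.mk.injEq] at hd
    -- The first row of this product is (a, b • Q 0), and its multiple by d is (v 0, g • Q 0).
    refine ⟨d, cornerBlock n a b (-y) x * bordered 1 Q,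
      (isUnit_cornerBlock n (by linear_combination hxy)).mul (isUnit_bordered hQ), ?_⟩
    ext i
    refine Fin.cases ?_ (fun i => ?_) i
    · simp [cornerBlock, bordered, Matrix.mul_apply, Fin.sum_univ_succ, hd.1]
    · have := congrFun hg i
      simp only [Fin.tail, Pi.smul_apply, smul_eq_mul] at this
      simp [cornerBlock, bordered, Matrix.mul_apply, Fin.sum_univ_succ, this, hd.2, mul_assoc]

/-- Over a Hermite ring each nonempty finite family is a multiple of a unimodular one. -/
theorem IsHermite.exists_eq_smul_unimodular (hR : IsHermite R) {ι : Type*} [Fintype ι]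
    [Nonempty ι] (v : ι → R) :
    ∃ (d : R) (w x : ι → R), v = d • w ∧ x ⬝ᵥ w = 1 := by
  obtain ⟨n, hn⟩ := Nat.exists_eq_succ_of_ne_zero (Fintype.card_ne_zero (α := ι))
  let e : ι ≃ Fin (n + 1) := (Fintype.equivFin ι).trans (finCongr hn)
  obtain ⟨g, Q, ⟨u, rfl⟩, hv⟩ := hR.exists_eq_smul_row (v ∘ e.symm)
  refine ⟨g, (u.val 0) ∘ e, (fun i => (u⁻¹).val i 0) ∘ e, ?_, ?_⟩
  · ext i
    simpa using congrFun hv (e i)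
  · rw [comp_equiv_dotProduct_comp_equiv, dotProduct_comm]
    simpa [Matrix.mul_apply, dotProduct] using congrFun (congrFun u.mul_inv 0) 0

/-- Over a Hermite ring a unimodular vector is the first row of an invertible matrix. -/
theorem IsHermite.exists_row_eq (hR : IsHermite R) {n : ℕ} {v x : Fin (n + 1) → R}
    (h : x ⬝ᵥ v = 1) :
    ∃ Q : Matrix (Fin (n + 1)) (Fin (n + 1)) R, IsUnit Q ∧ Q 0 = v := by
  obtain ⟨g, Q, hQ, hv⟩ := hR.exists_eq_smul_row v
  have hg : g * (x ⬝ᵥ Q 0) = 1 := by rw [← h, hv, dotProduct_smul, smul_eq_mul]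
  -- Since v is unimodular, g is a unit and can be absorbed into the first row.
  refine ⟨bordered g 1 * Q, ?_, ?_⟩
  · refine IsUnit.mul (IsUnit.of_mul_eq_one (bordered (x ⬝ᵥ Q 0) 1) ?_) hQ
    rw [bordered_mul, hg, one_mul, bordered_one]
  · ext j
    simp [hv, bordered, Matrix.mul_apply, Fin.sum_univ_succ]

/-! ### Representing 1: from size 2 × 2 to all sizes -/

/-- Every unimodular `m × n` matrix, seen as a bilinear form, takes the value `1`. -/
def RepresentsOne (R : Type*) [CommRing R] (m n : ℕ) : Prop :=
  ∀ A X : Matrix (Fin m) (Fin n) R, ∑ i, ∑ j, X i j * A i j = 1 →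
    ∃ (u : Fin m → R) (v : Fin n → R), u ⬝ᵥ A *ᵥ v = 1

theorem RepresentsOne.transpose {m n : ℕ} (h : RepresentsOne R m n) : RepresentsOne R n m := by
  intro A X hX
  obtain ⟨u, v, huv⟩ := h Aᵀ Xᵀ (by rw [Finset.sum_comm]; exact hX)
  refine ⟨v, u, ?_⟩
  rw [← huv, dotProduct_mulVec, dotProduct_comm, mulVec_transpose]

/-- Induction on the rows. The rows below the first are d • C with C unimodular, so by induction
some combination u of the rows of C is itself unimodular. Replacing the lower rows by d • (u C)
keeps the matrix unimodular and leaves two rows. -/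
theorem RepresentsOne.of_two_rows (hR : IsHermite R) {n : ℕ} (h : RepresentsOne R 2 (n + 1))
    (m : ℕ) : RepresentsOne R (m + 1) (n + 1) := by
  induction m with
  | zero =>
    intro A X hX
    refine ⟨1, X 0, ?_⟩
    simpa [dotProduct, mulVec, mul_comm] using hX
  | succ m ih =>
    intro A X hX
    obtain ⟨d, B, Y, hB, hY⟩ := hR.exists_eq_smul_unimodular
      (fun p : Fin (m + 1) × Fin (n + 1) => A p.1.succ p.2)
    have hB' : ∀ i j, A (Fin.succ i) j = d * B (i, j) := fun i j => congrFun hB (i, j)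
    obtain ⟨u, v, huv⟩ := ih (Matrix.of fun i j => B (i, j)) (Matrix.of fun i j => Y (i, j))
      (by simpa [dotProduct, Fintype.sum_prod_type] using hY)
    set C : Matrix (Fin (m + 1)) (Fin (n + 1)) R := Matrix.of fun i j => B (i, j) with hC
    have hAC : ∀ y : Fin (n + 1) → R, ∀ i : Fin (m + 1), (A *ᵥ y) i.succ = d * (C *ᵥ y) i := by
      intro y i
      simp [mulVec, dotProduct, hB', hC, Finset.mul_sum, mul_assoc]
    rw [dotProduct_mulVec] at huv
    set k : R := ∑ i : Fin (m + 1), ∑ j, X i.succ j * B (i, j) with hk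
    have hX' : A 0 ⬝ᵥ X 0 + d * k = 1 := by
      rw [← hX, Fin.sum_univ_succ]
      simp only [dotProduct, hB', hk, Finset.mul_sum]
      congr 1
      · exact Finset.sum_congr rfl fun _ _ => mul_comm _ _
      · exact Finset.sum_congr rfl fun _ _ => Finset.sum_congr rfl fun _ _ => by ring
    obtain ⟨s, y, hsy⟩ := h (Matrix.of ![A 0, d • (u ᵥ* C)]) (Matrix.of ![X 0, k • v]) (by
      have h1 : ∑ j, X 0 j * A 0 j = A 0 ⬝ᵥ X 0 := dotProduct_comm (X 0) (A 0)
      have h2 : ∑ j, k * v j * (d * (u ᵥ* C) j) = d * k := by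
        calc _ = d * k * ((u ᵥ* C) ⬝ᵥ v) := by
              rw [dotProduct, Finset.mul_sum]
              exact Finset.sum_congr rfl fun _ _ => by ring
          _ = _ := by rw [huv, mul_one]
      simpa [Fin.sum_univ_two, h1, h2] using hX')
    refine ⟨Fin.cons (s 0) (s 1 • u), y, ?_⟩
    rw [← hsy]
    have h3 : (d • (u ᵥ* C)) ⬝ᵥ y = ∑ i, u i * (d * (C *ᵥ y) i) := by
      rw [smul_dotProduct, ← dotProduct_mulVec, dotProduct, smul_eq_mul, Finset.mul_sum]
      exact Finset.sum_congr rfl fun _ _ => by ring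
    have h4 : (Matrix.of ![A 0, d • (u ᵥ* C)] *ᵥ y) 1 = (d • (u ᵥ* C)) ⬝ᵥ y := rfl
    have h5 : (Matrix.of ![A 0, d • (u ᵥ* C)] *ᵥ y) 0 = (A *ᵥ y) 0 := rfl
    rw [dotProduct, dotProduct, Fin.sum_univ_succ, Fin.sum_univ_two, h4, h5, h3, Finset.mul_sum]
    simp [hAC, mul_assoc]

theorem RepresentsOne.of_two_two (hR : IsHermite R) (h : RepresentsOne R 2 2) (m n : ℕ) :
    RepresentsOne R (m + 1) (n + 1) :=
  RepresentsOne.of_two_rows hR (RepresentsOne.of_two_rows hR h n).transpose m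

/-! ### Diagonal reduction -/

/-- A matrix whose corner entry is `1` is equivalent to a block diagonal one. -/
theorem exists_bordered_of_apply_zero_zero {m n : ℕ} (A : Matrix (Fin (m + 1)) (Fin (n + 1)) R)
    (h : A 0 0 = 1) :
    ∃ (P : Matrix (Fin (m + 1)) (Fin (m + 1)) R) (Q : Matrix (Fin (n + 1)) (Fin (n + 1)) R)
      (B : Matrix (Fin m) (Fin n) R), IsUnit P ∧ IsUnit Q ∧ P * A * Q = bordered 1 B := by
  let L : (Fin m → R) → Matrix (Fin (m + 1)) (Fin (m + 1)) R := fun c =>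
    Matrix.of (Fin.cons (Fin.cons 1 0) fun i => Fin.cons (c i) ((1 : Matrix _ _ R) i))
  let U : (Fin n → R) → Matrix (Fin (n + 1)) (Fin (n + 1)) R := fun r =>
    Matrix.of (Fin.cons (Fin.cons 1 r) fun i => Fin.cons 0 ((1 : Matrix _ _ R) i))
  have hL : ∀ c, IsUnit (L c) := fun c => by
    refine IsUnit.of_mul_eq_one (L (-c)) ?_
    ext i j
    refine Fin.cases ?_ (fun i => ?_) i <;> refine Fin.cases ?_ (fun j => ?_) j <;>
      simp [L, Matrix.mul_apply, Fin.sum_univ_succ, Matrix.one_apply,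
        (Fin.succ_ne_zero _).symm]
  have hU : ∀ r, IsUnit (U r) := fun r => by
    refine IsUnit.of_mul_eq_one (U (-r)) ?_
    ext i j
    refine Fin.cases ?_ (fun i => ?_) i <;> refine Fin.cases ?_ (fun j => ?_) j <;>
      simp [U, Matrix.mul_apply, Fin.sum_univ_succ, Matrix.one_apply,
        (Fin.succ_ne_zero _).symm]
  refine ⟨L fun i => -A i.succ 0, U fun j => -A 0 j.succ,
    Matrix.of fun i j => A i.succ j.succ - A i.succ 0 * A 0 j.succ, hL _, hU _, ?_⟩
  ext i j
  refine Fin.cases ?_ (fun i => ?_) i <;> refine Fin.cases ?_ (fun j => ?_) j <;>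
    simp [L, U, bordered, Matrix.mul_apply, Fin.sum_univ_succ, Matrix.one_apply, h]
  ring

/-- Over a Hermite ring whose unimodular matrices represent `1`, each matrix is equivalent to a
block diagonal one whose first block divides the second one. -/
theorem exists_smul_bordered (hR : IsHermite R) {m n : ℕ} (h : RepresentsOne R (m + 1) (n + 1))
    (A : Matrix (Fin (m + 1)) (Fin (n + 1)) R) :
    ∃ (P : Matrix (Fin (m + 1)) (Fin (m + 1)) R) (Q : Matrix (Fin (n + 1)) (Fin (n + 1)) R)
      (d : R) (B : Matrix (Fin m) (Fin n) R),
      IsUnit P ∧ IsUnit Q ∧ P * A * Q = bordered d (d • B) := by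
  obtain ⟨d, w, x, hw, hx⟩ := hR.exists_eq_smul_unimodular
    (fun p : Fin (m + 1) × Fin (n + 1) => A p.1 p.2)
  let C : Matrix (Fin (m + 1)) (Fin (n + 1)) R := Matrix.of fun i j => w (i, j)
  have hA : A = d • C := by
    ext i j
    exact congrFun hw (i, j)
  obtain ⟨u, v, huv⟩ := h C (Matrix.of fun i j => x (i, j))
    (by simpa [C, dotProduct, Fintype.sum_prod_type] using hx)
  -- The equation u C v = 1 shows that u and v are unimodular, so they become the first row of P and
  -- the first column of Qᵀ.
  obtain ⟨P, hP, hPu⟩ := hR.exists_row_eq (v := u) (x := C *ᵥ v) (by rw [dotProduct_comm, huv])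
  obtain ⟨Q, hQ, hQv⟩ := hR.exists_row_eq (v := v) (x := u ᵥ* C) (by rw [← dotProduct_mulVec, huv])
  have h1 : (P * C * Qᵀ) 0 0 = 1 := by
    rw [Matrix.mul_assoc, Matrix.mul_apply', hPu, ← huv]
    congr 1
    ext i
    rw [← hQv]
    rfl
  obtain ⟨P', Q', B, hP', hQ', hB⟩ := exists_bordered_of_apply_zero_zero _ h1
  refine ⟨P' * P, Qᵀ * Q', d, B, hP'.mul hP, ((Matrix.isUnit_transpose Q).2 hQ).mul hQ', ?_⟩
  calc P' * P * A * (Qᵀ * Q') = d • (P' * (P * C * Qᵀ) * Q') := by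
        simp only [hA, Matrix.mul_smul, Matrix.smul_mul, Matrix.mul_assoc]
    _ = bordered d (d • B) := by
        rw [hB]
        ext i j
        refine Fin.cases ?_ (fun i => ?_) i <;> refine Fin.cases ?_ (fun j => ?_) j <;>
          simp [bordered]

theorem IsDiagonalReduced.bordered_smul {m n : ℕ} {D : Matrix (Fin m) (Fin n) R}
    (hD : IsDiagonalReduced D) (d : R) : IsDiagonalReduced (bordered d (d • D)) := by
  refine ⟨fun i j => ?_, ?_⟩
  · refine Fin.cases ?_ (fun i => ?_) i <;> refine Fin.cases ?_ (fun j => ?_) j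
    · simp
    · simp [bordered]
    · simp [bordered]
    · intro hij
      simp [bordered, hD.1 i j (by simpa using hij)]
  · rintro (_ | k) hm hn
    · exact ⟨D ⟨0, by omega⟩ ⟨0, by omega⟩, rfl⟩
    · exact mul_dvd_mul_left d (hD.2 k (by omega) (by omega))

theorem admitsDiagonalReduction_iff {m n : ℕ} (A : Matrix (Fin m) (Fin n) R) :
    AdmitsDiagonalReduction A ↔ ∃ (P : Matrix (Fin m) (Fin m) R) (Q : Matrix (Fin n) (Fin n) R),
      IsUnit P ∧ IsUnit Q ∧ IsDiagonalReduced (P * A * Q) :=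
  ⟨fun ⟨P, Q, h⟩ => ⟨P, Q, P.isUnit, Q.isUnit, h⟩,
    fun ⟨_, _, ⟨P, hP⟩, ⟨Q, hQ⟩, h⟩ => ⟨P, Q, by rw [hP, hQ]; exact h⟩⟩

/-- A Hermite ring whose unimodular `2 × 2` matrices represent `1` is an elementary divisor
ring. -/
theorem IsHermite.isEDR (hR : IsHermite R) (h : RepresentsOne R 2 2) : IsEDR R := by
  intro m
  induction m with
  | zero => exact fun n A => ⟨1, 1, fun i => i.elim0, fun k hm => by omega⟩
  | succ m ih =>
    rintro (_ | n) A
    · exact ⟨1, 1, fun _ j => j.elim0, fun k _ hn => by omega⟩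
    obtain ⟨P, Q, d, B, hP, hQ, hB⟩ :=
      exists_smul_bordered hR (RepresentsOne.of_two_two hR h m n) A
    obtain ⟨P', Q', hP', hQ', hD⟩ := (admitsDiagonalReduction_iff B).1 (ih n B)
    refine (admitsDiagonalReduction_iff A).2 ⟨bordered 1 P' * P, Q * bordered 1 Q',
      (isUnit_bordered hP').mul hP, hQ.mul (isUnit_bordered hQ'), ?_⟩
    have : bordered 1 P' * P * A * (Q * bordered 1 Q') = bordered d (d • (P' * B * Q')) := by
      calc _ = bordered 1 P' * (P * A * Q) * bordered 1 Q' := by simp only [Matrix.mul_assoc]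
        _ = _ := by
          rw [hB, bordered_mul, bordered_mul, one_mul, mul_one, Matrix.mul_smul, Matrix.smul_mul]
    rw [this]
    exact hD.bordered_smul d

/-! ### Symmetric 2 × 2 matrices and the quadratic condition -/

/-- Over a Hermite ring, `(e, f)` with `(ae² - cf², ac - b²)` unimodular may be taken such that
`(e, f)` times the symmetric matrix with entries `a, b, c` is unimodular. -/
theorem IsHermite.exists_symm_form_eq_one (hR : IsHermite R) {a b c e f : R}
    (h : IsUnimodular R (a * e ^ 2 - c * f ^ 2, a * c - b ^ 2)) :
    ∃ s t p q : R, (s * a + t * b) * p + (s * b + t * c) * q = 1 := by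
  obtain ⟨d, ⟨s, t⟩, hu, hd⟩ := hR (e, f)
  simp only [Prod.smul_mk, smul_eq_mul, Prod.mk.injEq] at hd
  obtain ⟨rfl, rfl⟩ := hd
  obtain ⟨x, y, hxy⟩ := (isUnimodular_pair_iff _ _).1 h
  obtain ⟨z, w, hzw⟩ := (isUnimodular_pair_iff _ _).1 hu
  -- The vector (p, q) is x d² (s, -t) plus y times the adjugate of S applied to (z, w); pairing
  -- with (s, t)S gives x(ae² - cf²) from the first and y det S from the second.
  refine ⟨s, t, x * d ^ 2 * s + y * (z * c - w * b), -(x * d ^ 2 * t) + y * (w * a - z * b), ?_⟩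
  linear_combination hxy + y * (a * c - b ^ 2) * hzw

theorem IsSU.representsOne (hR : IsSU 2 R)
    (h : ∀ a b c : R, IsUnimodular R (a, b, c) →
      ∃ e f : R, IsUnimodular R (a * e ^ 2 - c * f ^ 2, a * c - b ^ 2)) :
    RepresentsOne R 2 2 := by
  intro A X hX
  obtain ⟨N, hN⟩ := hR.2 A ((isUnimodular_matrix_iff A).2 ⟨X, hX⟩)
  set S : Matrix (Fin 2) (Fin 2) R := A * N.val with hS
  have hA : A = S * N⁻¹.val := by rw [hS, Matrix.mul_assoc, Units.mul_inv, Matrix.mul_one]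
  have h10 : S 1 0 = S 0 1 := hN.apply 0 1
  -- The entries of A = S N⁻¹ are combinations of those of S, so S inherits unimodularity.
  have hX' : IsUnimodular R (S 0 0, S 0 1, S 1 1) := by
    rw [isUnimodular_triple_iff]
    have hA' : ∀ i j, A i j = S i 0 * N⁻¹.val 0 j + S i 1 * N⁻¹.val 1 j := fun i j => by
      conv_lhs => rw [hA]
      rw [Matrix.mul_apply, Fin.sum_univ_two]
    simp only [Fin.sum_univ_two, hA', h10] at hX
    set M := N⁻¹.val
    exact ⟨X 0 0 * M 0 0 + X 0 1 * M 0 1,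
      X 0 0 * M 1 0 + X 0 1 * M 1 1 + X 1 0 * M 0 0 + X 1 1 * M 0 1,
      X 1 0 * M 1 0 + X 1 1 * M 1 1, by linear_combination hX⟩
  obtain ⟨e, f, hef⟩ := h _ _ _ hX'
  obtain ⟨s, t, p, q, hst⟩ := hR.1.exists_symm_form_eq_one hef
  refine ⟨![s, t], N.val *ᵥ ![p, q], ?_⟩
  rw [mulVec_mulVec, ← hS]
  simp only [dotProduct, mulVec, Fin.sum_univ_two, Matrix.cons_val_zero, Matrix.cons_val_one, h10]
  linear_combination hst

/-- The corner of the reduced form divides every entry of A, hence is a unit; the first row of P and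
the first column of Q then do, up to scaling. -/
theorem IsEDR.representsOne (hR : IsEDR R) : RepresentsOne R 2 2 := by
  intro A X hX
  obtain ⟨P, Q, hoff, hdvd⟩ := hR 2 2 A
  set D := P.val * A * Q.val with hD
  have hA : A = P⁻¹.val * D * Q⁻¹.val := by
    rw [hD, Matrix.mul_assoc, Matrix.mul_assoc, Matrix.mul_assoc, Units.mul_inv, Matrix.mul_one,
      ← Matrix.mul_assoc, Units.inv_mul, Matrix.one_mul]
  obtain ⟨g, hg⟩ : D 0 0 ∣ D 1 1 := hdvd 0 (by omega) (by omega)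
  have h01 : D 0 1 = 0 := hoff 0 1 (by simp)
  have h10 : D 1 0 = 0 := hoff 1 0 (by simp)
  have hDA : ∀ i j, D 0 0 ∣ A i j := by
    intro i j
    rw [hA]
    simp only [Matrix.mul_apply, Fin.sum_univ_two, h01, h10, hg]
    exact ⟨P⁻¹.val i 0 * Q⁻¹.val 0 j + P⁻¹.val i 1 * g * Q⁻¹.val 1 j, by ring⟩
  obtain ⟨k, hk⟩ : D 0 0 ∣ 1 := hX ▸ Finset.dvd_sum fun i _ => Finset.dvd_sum fun j _ =>
    (hDA i j).mul_left _
  refine ⟨P.val 0, k • fun j => Q.val j 0, ?_⟩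
  rw [mulVec_smul, dotProduct_smul, dotProduct_mulVec, smul_eq_mul, hk, mul_comm]
  rfl

theorem exists_quadratic_unimodular_of_charP_two [CharP R 2] (h : RepresentsOne R 2 2) {a b c : R}
    (habc : IsUnimodular R (a, b, c)) :
    ∃ e f : R, IsUnimodular R (a * e ^ 2 - c * f ^ 2, a * c - b ^ 2) := by
  obtain ⟨x, y, z, hxyz⟩ := (isUnimodular_triple_iff a b c).1 habc
  obtain ⟨u, v, huv⟩ := h !![a, b; b, c] !![x, y; 0, z]
    (by simpa [Fin.sum_univ_two, ← add_assoc] using hxyz)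
  have h2 : (2 : R) = 0 := CharTwo.two_eq_zero
  simp only [dotProduct, mulVec, Fin.sum_univ_two, Matrix.of_apply, Matrix.cons_val_zero,
    Matrix.cons_val_one] at huv
  refine ⟨u 0, u 1, (isUnimodular_pair_iff _ _).2
    ⟨a * v 0 ^ 2 + 2 * b * v 0 * v 1 + c * v 1 ^ 2, -(u 0 * v 1 - u 1 * v 0) ^ 2, ?_⟩⟩
  -- The Gram determinant identity with uᵀSv = 1; the `h2` term replaces uᵀSu by a u₀² - c u₁².
  linear_combination
    (u 0 * (a * v 0 + b * v 1) + u 1 * (b * v 0 + c * v 1) + 1) * huv -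
      (a * v 0 ^ 2 + 2 * b * v 0 * v 1 + c * v 1 ^ 2) * (b * u 0 * u 1 + c * u 1 ^ 2) * h2

end UnimodularRings

theorem mainTheorem7 (R : Type*) [CommRing R] (hR : UnimodularRings.IsSU 2 R) :
    ((∀ a b c : R, UnimodularRings.IsUnimodular R (a, b, c) →
        ∃ e f : R, UnimodularRings.IsUnimodular R (a * e ^ 2 - c * f ^ 2, a * c - b ^ 2)) →
      UnimodularRings.IsEDR R) ∧
    (CharP R 2 → UnimodularRings.IsEDR R →
      ∀ a b c : R, UnimodularRings.IsUnimodular R (a, b, c) →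
        ∃ e f : R, UnimodularRings.IsUnimodular R (a * e ^ 2 - c * f ^ 2, a * c - b ^ 2)) :=
  ⟨fun h => hR.1.isEDR (hR.representsOne h), fun _ hE _ _ _ habc =>
    UnimodularRings.exists_quadratic_unimodular_of_charP_two hE.representsOne habc⟩
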